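/- **Proposition 3 (rectified webs).** Let $\mathcal O=\mathbb C\{x,y\}$ and let $F_3,F_4\in\mathcal O$ vanish at $0$ and be such that $(F_1,F_2,F_3,F_4)=(x,y,F_3,F_4)$ defines a nonsingular 4-web $\mathcal W(4)$ of $(\mathbb C^2,0)$, i.e. $dF_i(0)\wedge dF_j(0)\neq 0$ for $i<j$. Let $$F=u\prod_{i=1}^4\bigl(\partial_y(F_i)\,p+\partial_x(F_i)\bigr)\in\mathcal O[p],\qquad u\in\mathcal O^*,$$ be a presentation of $\mathcal W(4)$ by a differential equation $F(x,y,y')=0$ (the leaves $x=\mathrm{const}$ correspond to the root $p=\infty$). Let $(A_{ij})$ be the matrix with coefficients in $\mathcal O$ such that, for all $b_3,b_4\in\mathcal O$ and on every branch $p=p(x,y)$ of $F=0$, $$\partial_pF\cdot d\Bigl((b_3p+b_4)\tfrac{dy-p\,dx}{\partial_pF}\Bigr)=\bigl(M_1+M_2\,p+M_3\,p^2\bigr)\,dx\wedge dy,$$ where $$M_1=\partial_x(b_4)+A_{11}b_3+A_{12}b_4,\quad M_2=\partial_x(b_3)+\partial_y(b_4)+A_{21}b_3+A_{22}b_4,\quad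 M_3=\partial_y(b_3)+A_{31}b_3+A_{32}b_4 .$$ Let $R_0\subset J_1(\mathcal O^2)$ be the module of 1-jets satisfying the system $M_1=M_2=M_3=0$, let $E\subset J_2(\mathcal O^2)$ be its first prolongation (the 2-jets satisfying the system and its total $x$- and $y$-derivatives), and let $\nabla:E\to\Omega^1\otimes_{\mathcal O}E$ be the connection obtained by composing the Spencer operator $E\to\Omega^1\otimes R_0$ (derivative of the truncated jet minus the shifted jet) with the inverse of the isomorphism $E\to R_0$. A basis $(e_1,e_2,e_3)$ of $E$ is called *adapted* if $e_1$ generates the kernel of $E\to J_0(\mathcal O^2)$ and all rows of the curvature matrix of $\nabla$ other than the first vanish. For a 3-web $(G_1,G_2,G_3)$, its Blaschke curvature is $d\gamma$, where $\gamma$ is a 1-form with $d\omega_i=\gamma\wedge\omega_i$ for forms $\omega_i=\rho_i\,dG_i$, $\rho_i\in\mathcal O^*$, with $\omega_1+\omega_2+\omega_3=0$. Let $K_x\,dx\wedge dy$, $K_y\,dx\wedge dy$, $K_3\,dx\wedge dy$, $K_4\,dx\wedge dy$ be the Blaschke curvatures of the 3-webs obtained from $\mathcal W(4)$ by removing $x$,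 $y$, $F_3$, $F_4$ respectively. Let $P_{\mathcal W(4)}=-v_1p^3-v_2p^2-v_3p-v_4$ be the polynomial of degree at most $3$ with coefficients in $\mathcal O$ such that all leaves of $\mathcal W(4)$ are solutions of $y''=P_{\mathcal W(4)}(x,y,y')$; that is, $P_{\mathcal W(4)}(x,y,p_i)=\partial_x(p_i)+p_i\,\partial_y(p_i)$ for the slopes $p_i$ of the leaves of $y$, $F_3$, $F_4$, and, for the leaves $x=\mathrm{const}$, $v_1=0$. Then $E$ has an adapted basis in which the curvature matrix of $(E,\nabla)$ is $$\begin{pmatrix}k_1&k_2&k_3\\0&0&0\\0&0&0\end{pmatrix}dx\wedge dy,\qquad k_1=K_x+K_y+K_3+K_4,\quad k_2=\partial_x(K_y)+v_3K_y,\quad k_3=\partial_y(K_x)-v_2K_x .$$ -/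

import Mathlib

open scoped Topology

namespace PlaneWeb

noncomputable section

/-! ### The ring `𝒪 = ℂ{x, y}` and its partial derivatives -/

/-- The ring `𝒪` of germs at `0` of holomorphic functions of two complex variables. -/
def holGerms : Subring (Filter.Germ (𝓝 (0 : ℂ × ℂ)) ℂ) where
  carrier := {φ | ∃ f : ℂ × ℂ → ℂ, AnalyticAt ℂ f 0 ∧ φ = Filter.Germ.ofFun f}
  mul_mem' := by
    rintro _ _ ⟨f, hf, rfl⟩ ⟨g, hg, rfl⟩
    exact ⟨f * g, hf.mul hg, rfl⟩
  one_mem' := ⟨1, analyticAt_const, rfl⟩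
  add_mem' := by
    rintro _ _ ⟨f, hf, rfl⟩ ⟨g, hg, rfl⟩
    exact ⟨f + g, hf.add hg, rfl⟩
  zero_mem' := ⟨0, analyticAt_const, rfl⟩
  neg_mem' := by
    rintro _ ⟨f, hf, rfl⟩
    exact ⟨-f, hf.neg, rfl⟩

/-- Germs at `0 ∈ ℂ²` of holomorphic functions. -/
abbrev 𝒪 : Type := holGerms

/-- The germ of a function which is analytic at the origin. -/
def mkGerm (f : ℂ × ℂ → ℂ) (hf : AnalyticAt ℂ f 0) : 𝒪 := ⟨f, f, hf, rfl⟩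

/-- The coordinate germ `x`. -/
def xGerm : 𝒪 := mkGerm Prod.fst analyticAt_fst

/-- The coordinate germ `y`. -/
def yGerm : 𝒪 := mkGerm Prod.snd analyticAt_snd

/-- The value of a germ at the origin. -/
def valueAt0 (f : 𝒪) : ℂ := f.1.value

/-- The derivative of an arbitrary germ in the constant direction `v`. -/
def germDeriv (v : ℂ × ℂ) (φ : Filter.Germ (𝓝 (0 : ℂ × ℂ)) ℂ) :
    Filter.Germ (𝓝 (0 : ℂ × ℂ)) ℂ :=
  Filter.Germ.map' (fun (f : ℂ × ℂ → ℂ) z => fderiv ℂ f z v)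
    (by
      intro f g h
      have h' : f =ᶠ[𝓝 0] g := h
      filter_upwards [h'.fderiv (𝕜 := ℂ)] with z hz
      simp only [hz]) φ

/-- The derivative in the constant direction `v`, as a derivation of the ring `𝒪`. -/
def partialDeriv (v : ℂ × ℂ) : Derivation ℤ 𝒪 𝒪 :=
  Derivation.mk' (AddMonoidHom.toIntLinearMap
    { toFun := fun φ => ⟨germDeriv v φ.1, by
        obtain ⟨_, f, hf, rfl⟩ := φ
        exact ⟨fun z => fderiv ℂ f z v,
          ((ContinuousLinearMap.apply ℂ ℂ v :
            (ℂ × ℂ →L[ℂ] ℂ) →L[ℂ] ℂ).analyticAt _).comp hf.fderiv, rfl⟩⟩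
      map_zero' := by
        apply Subtype.ext
        change Filter.Germ.ofFun (fun z : ℂ × ℂ => fderiv ℂ (fun _ => (0 : ℂ)) z v) = _
        simp only [fderiv_fun_const]
        rfl
      map_add' := by
        rintro ⟨_, f, hf, rfl⟩ ⟨_, g, hg, rfl⟩
        apply Subtype.ext
        change Filter.Germ.ofFun (fun z => fderiv ℂ (f + g) z v) =
          Filter.Germ.ofFun (fun z => fderiv ℂ f z v + fderiv ℂ g z v)
        refine Quotient.sound' ?_
        filter_upwards [hf.eventually_analyticAt, hg.eventually_analyticAt] with z h1 h2
        rw [fderiv_add h1.differentiableAt h2.differentiableAt]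
        rfl }) (by
    rintro ⟨_, f, hf, rfl⟩ ⟨_, g, hg, rfl⟩
    apply Subtype.ext
    change Filter.Germ.ofFun (fun z => fderiv ℂ (f * g) z v) =
      Filter.Germ.ofFun (fun z => f z * fderiv ℂ g z v + g z * fderiv ℂ f z v)
    refine Quotient.sound' ?_
    filter_upwards [hf.eventually_analyticAt, hg.eventually_analyticAt] with z h1 h2
    rw [fderiv_mul h1.differentiableAt h2.differentiableAt]
    rfl)

/-- `∂/∂x`. -/
def dX : Derivation ℤ 𝒪 𝒪 := partialDeriv (1, 0)

/-- `∂/∂y`. -/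
def dY : Derivation ℤ 𝒪 𝒪 := partialDeriv (0, 1)

/-! ### Differential forms

The 1-form `a dx + b dy` is the pair `(a, b)`; the 2-form `c dx ∧ dy` is its coefficient `c`. -/

/-- The differential of a function. -/
def dFun (f : 𝒪) : 𝒪 × 𝒪 := (dX f, dY f)

/-- The wedge product of two 1-forms. -/
def wedge (ω η : 𝒪 × 𝒪) : 𝒪 := ω.1 * η.2 - ω.2 * η.1

/-- The exterior derivative of a 1-form. -/
def dForm (ω : 𝒪 × 𝒪) : 𝒪 := dX ω.2 - dY ω.1

/-! ### Webs and Blaschke curvature -/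

/-- The level curves of `W 0, …, W (d - 1)` form a nonsingular `d`-web of `(ℂ², 0)`. -/
structure IsWeb {d : ℕ} (W : Fin d → 𝒪) : Prop where
  value_eq_zero : ∀ i, valueAt0 (W i) = 0
  transverse : ∀ i j, i < j → valueAt0 (wedge (dFun (W i)) (dFun (W j))) ≠ 0

/-- `K dx ∧ dy` is the Blaschke curvature of the 3-web given by `W`: it is `dγ`, where
`dωᵢ = γ ∧ ωᵢ` for forms `ωᵢ = ρᵢ dWᵢ`, `ρᵢ` invertible, with `ω₀ + ω₁ + ω₂ = 0`. -/
def IsBlaschkeCurvature (W : Fin 3 → 𝒪) (K : 𝒪) : Prop :=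
  ∃ (ρ : Fin 3 → 𝒪) (γ : 𝒪 × 𝒪), (∀ i, IsUnit (ρ i)) ∧
    ∑ i, ρ i • dFun (W i) = 0 ∧
    (∀ i, dForm (ρ i • dFun (W i)) = wedge γ (ρ i • dFun (W i))) ∧
    K = dForm γ

/-! ### Presentation of a 4-web by a differential equation -/

/-- The differential equation `F(x, y, y') = 0` presents the web given by `W`: up to an
invertible factor, `F` is the product of the `∂y(Wᵢ) p + ∂x(Wᵢ)`. A family of leaves with
`∂y(Wᵢ) = 0` (vertical leaves) contributes an invertible factor, so it corresponds to a
root at infinity. -/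
def IsPresentation {d : ℕ} (W : Fin d → 𝒪) (F : Polynomial 𝒪) : Prop :=
  ∃ u : 𝒪, IsUnit u ∧
    F = Polynomial.C u *
      ∏ i, (Polynomial.C (dY (W i)) * Polynomial.X + Polynomial.C (dX (W i)))

/-- `P` is the polynomial of degree at most `3` in `p` such that all leaves of the 4-web given by
`W` solve `y'' = P(x, y, y')`. On the leaves `Wᵢ = const` of slope `p` this means
`P(p) = ∂x(p) + p ∂y(p)`. Written for `x` as a function of `y`, the equation is
`x'' = -(P₃ + P₂ x' + P₁ x'² + P₀ x'³)`, so vertical leaves (`∂y(Wᵢ) = 0`) solve it exactly when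
the coefficient `P₃` vanishes. -/
structure IsLeafPolynomial (W : Fin 4 → 𝒪) (P : Polynomial 𝒪) : Prop where
  natDegree_le : P.natDegree ≤ 3
  eval_slope : ∀ (i : Fin 4) (p : 𝒪), dX (W i) + p * dY (W i) = 0 →
    P.eval p = dX p + p * dY p
  vertical : ∀ i : Fin 4, dY (W i) = 0 → P.coeff 3 = 0

/-- The restriction to the branch `p` (a root of `F`) of the surface `F(x, y, p) = 0` of the form
`(b₃ p + b₄) (dy - p dx) / ∂ₚF`. Here `b 0 = b₃` and `b 1 = b₄`. -/
def branchForm (F : Polynomial 𝒪) (b : Fin 2 → 𝒪) (p : 𝒪) : 𝒪 × 𝒪 :=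
  ((b 0 * p + b 1) * Ring.inverse (F.derivative.eval p)) • ((-p, 1) : 𝒪 × 𝒪)

/-! ### Jets and the linear differential system of abelian relations -/

/-- Multi-indices of order at most 1. -/
inductive Idx1
  | o | x | y

/-- Multi-indices of order at most 2. -/
inductive Idx2
  | o | x | y | xx | xy | yy

/-- Sections of `J₁(𝒪²)`. -/
abbrev Jet1 : Type := Idx1 → Fin 2 → 𝒪

/-- Sections of `J₂(𝒪²)`. -/
abbrev Jet2 : Type := Idx2 → Fin 2 → 𝒪

/-- The 1-jet of `b`. -/
def jet1 (b : Fin 2 → 𝒪) : Jet1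
  | .o => b
  | .x => fun c => dX (b c)
  | .y => fun c => dY (b c)

/-- The projection `J₂(𝒪²) → J₁(𝒪²)`. -/
def trunc : Jet2 →ₗ[𝒪] Jet1 where
  toFun j := fun
    | .o => j .o
    | .x => j .x
    | .y => j .y
  map_add' _ _ := by ext i c; cases i <;> rfl
  map_smul' _ _ := by ext i c; cases i <;> rfl

/-- The 1-jet of formal `x`-derivatives in a 2-jet. -/
def shiftX : Jet2 →ₗ[𝒪] Jet1 where
  toFun j := fun
    | .o => j .x
    | .x => j .xx
    | .y => j .xy
  map_add' _ _ := by ext i c; cases i <;> rfl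
  map_smul' _ _ := by ext i c; cases i <;> rfl

/-- The 1-jet of formal `y`-derivatives in a 2-jet. -/
def shiftY : Jet2 →ₗ[𝒪] Jet1 where
  toFun j := fun
    | .o => j .y
    | .x => j .xy
    | .y => j .yy
  map_add' _ _ := by ext i c; cases i <;> rfl
  map_smul' _ _ := by ext i c; cases i <;> rfl

/-- The left-hand sides of the system with coefficient matrix `A`
`∂x(b₄) + A₁₁ b₃ + A₁₂ b₄ = 0`, `∂x(b₃) + ∂y(b₄) + A₂₁ b₃ + A₂₂ b₄ = 0`,
`∂y(b₃) + A₃₁ b₃ + A₃₂ b₄ = 0`, on 1-jets. -/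
def sys (A : Matrix (Fin 3) (Fin 2) 𝒪) : Jet1 →ₗ[𝒪] (Fin 3 → 𝒪) where
  toFun j :=
    ![j .x 1 + (A 0 0 * j .o 0 + A 0 1 * j .o 1),
      j .x 0 + j .y 1 + (A 1 0 * j .o 0 + A 1 1 * j .o 1),
      j .y 0 + (A 2 0 * j .o 0 + A 2 1 * j .o 1)]
  map_add' j k := by
    funext i; fin_cases i <;> simp <;> ring
  map_smul' r j := by
    funext i; fin_cases i <;> simp <;> ring

/-- The formal total `x`-derivatives of the equations of the system, on 2-jets. -/
def sysX (A : Matrix (Fin 3) (Fin 2) 𝒪) : Jet2 →ₗ[𝒪] (Fin 3 → 𝒪) :=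
  (sys A).comp shiftX + (Matrix.mulVecLin (A.map dX)).comp (LinearMap.proj Idx2.o)

/-- The formal total `y`-derivatives of the equations of the system, on 2-jets. -/
def sysY (A : Matrix (Fin 3) (Fin 2) 𝒪) : Jet2 →ₗ[𝒪] (Fin 3 → 𝒪) :=
  (sys A).comp shiftY + (Matrix.mulVecLin (A.map dY)).comp (LinearMap.proj Idx2.o)

/-- The matrix `A` is that of the system attached to the equation `F` presenting a 4-web: on each
branch `p` of the surface `F = 0`, the differential of `(b₃ p + b₄) (dy - p dx) / ∂ₚF`,
multiplied by `∂ₚF`, is the polynomial in `p` of degree at most 2 whose coefficients are the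
left-hand sides of the system. -/
def IsSystemOf (F : Polynomial 𝒪) (A : Matrix (Fin 3) (Fin 2) 𝒪) : Prop :=
  ∀ (b : Fin 2 → 𝒪) (p : 𝒪), F.IsRoot p →
    F.derivative.eval p * dForm (branchForm F b p) =
      sys A (jet1 b) 0 + sys A (jet1 b) 1 * p + sys A (jet1 b) 2 * p ^ 2

/-! ### The bundle `E` and its connection -/

/-- The 1-jets satisfying the system. -/
def R0 (A : Matrix (Fin 3) (Fin 2) 𝒪) : Submodule 𝒪 Jet1 := LinearMap.ker (sys A)

/-- The sections of the bundle `E ⊆ J₂(𝒪²)`: the first prolongation of the system. -/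
def E (A : Matrix (Fin 3) (Fin 2) 𝒪) : Submodule 𝒪 Jet2 :=
  (R0 A).comap trunc ⊓ LinearMap.ker (sysX A) ⊓ LinearMap.ker (sysY A)

/-- The projection of `E` to the 1-jets satisfying the system. -/
def projE (A : Matrix (Fin 3) (Fin 2) 𝒪) : E A →ₗ[𝒪] R0 A :=
  trunc.restrict (p := E A) (q := R0 A) fun _ h => h.1.1

theorem mem_R0 (A : Matrix (Fin 3) (Fin 2) 𝒪) (j : Jet1) : j ∈ R0 A ↔
    j .x 1 + (A 0 0 * j .o 0 + A 0 1 * j .o 1) = 0 ∧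
    j .x 0 + j .y 1 + (A 1 0 * j .o 0 + A 1 1 * j .o 1) = 0 ∧
    j .y 0 + (A 2 0 * j .o 0 + A 2 1 * j .o 1) = 0 := by
  rw [R0, LinearMap.mem_ker, funext_iff, Fin.forall_fin_succ, Fin.forall_fin_two]
  simp [sys]

theorem mem_ker_sysX (A : Matrix (Fin 3) (Fin 2) 𝒪) (j : Jet2) : j ∈ LinearMap.ker (sysX A) ↔
    j .xx 1 + (A 0 0 * j .x 0 + A 0 1 * j .x 1) + (dX (A 0 0) * j .o 0 + dX (A 0 1) * j .o 1) = 0 ∧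
    j .xx 0 + j .xy 1 + (A 1 0 * j .x 0 + A 1 1 * j .x 1)
      + (dX (A 1 0) * j .o 0 + dX (A 1 1) * j .o 1) = 0 ∧
    j .xy 0 + (A 2 0 * j .x 0 + A 2 1 * j .x 1)
      + (dX (A 2 0) * j .o 0 + dX (A 2 1) * j .o 1) = 0 := by
  rw [LinearMap.mem_ker, funext_iff, Fin.forall_fin_succ, Fin.forall_fin_two]
  simp [sysX, sys, shiftX, Matrix.mulVec, dotProduct]

theorem mem_ker_sysY (A : Matrix (Fin 3) (Fin 2) 𝒪) (j : Jet2) : j ∈ LinearMap.ker (sysY A) ↔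
    j .xy 1 + (A 0 0 * j .y 0 + A 0 1 * j .y 1) + (dY (A 0 0) * j .o 0 + dY (A 0 1) * j .o 1) = 0 ∧
    j .xy 0 + j .yy 1 + (A 1 0 * j .y 0 + A 1 1 * j .y 1)
      + (dY (A 1 0) * j .o 0 + dY (A 1 1) * j .o 1) = 0 ∧
    j .yy 0 + (A 2 0 * j .y 0 + A 2 1 * j .y 1)
      + (dY (A 2 0) * j .o 0 + dY (A 2 1) * j .o 1) = 0 := by
  rw [LinearMap.mem_ker, funext_iff, Fin.forall_fin_succ, Fin.forall_fin_two]
  simp [sysY, sys, shiftY, Matrix.mulVec, dotProduct]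

theorem mem_E (A : Matrix (Fin 3) (Fin 2) 𝒪) (j : Jet2) :
    j ∈ E A ↔ trunc j ∈ R0 A ∧ j ∈ LinearMap.ker (sysX A) ∧ j ∈ LinearMap.ker (sysY A) := by
  rw [E, Submodule.mem_inf, Submodule.mem_inf, Submodule.mem_comap, and_assoc]

/-- Elements of `R0` have unique lifts to `E`. -/
theorem projE_bijective (A : Matrix (Fin 3) (Fin 2) 𝒪) : Function.Bijective (projE A) := by
  constructor
  · rw [← LinearMap.ker_eq_bot, LinearMap.ker_eq_bot']
    rintro ⟨j, hj⟩ h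
    have h0 : trunc j = 0 := congrArg Subtype.val h
    obtain ⟨-, hx, hy⟩ := (mem_E A j).1 hj
    have ho : j .o = 0 := congrFun h0 .o
    have h1 : j .x = 0 := congrFun h0 .x
    have h2 : j .y = 0 := congrFun h0 .y
    rw [mem_ker_sysX] at hx
    rw [mem_ker_sysY] at hy
    simp only [ho, h1, h2, Pi.zero_apply, mul_zero, add_zero] at hx hy
    obtain ⟨e1, e2, e3⟩ := hx
    obtain ⟨e4, e5, e6⟩ := hy
    rw [e4, add_zero] at e2
    rw [e3, zero_add] at e5
    apply Subtype.ext
    ext i c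
    cases i <;> fin_cases c <;> simp [ho, h1, h2, e1, e2, e3, e4, e5, e6]
  · rintro ⟨j, hj⟩
    let r (d : Derivation ℤ 𝒪 𝒪) (k : Fin 2 → 𝒪) (i : Fin 3) : 𝒪 :=
      (A i 0 * k 0 + A i 1 * k 1) + (d (A i 0) * j .o 0 + d (A i 1) * j .o 1)
    let J : Jet2 := fun
      | .o => j .o
      | .x => j .x
      | .y => j .y
      | .xx => ![r dY (j .y) 0 - r dX (j .x) 1, - r dX (j .x) 0]
      | .xy => ![- r dX (j .x) 2, - r dY (j .y) 0]
      | .yy => ![- r dY (j .y) 2, r dX (j .x) 2 - r dY (j .y) 1]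
    have ht : trunc J = j := by
      ext i c
      cases i <;> rfl
    refine ⟨⟨J, (mem_E A J).2 ⟨by rw [ht]; exact hj, ?_, ?_⟩⟩, Subtype.ext ht⟩
    · rw [mem_ker_sysX]
      simp only [J, r, Matrix.cons_val_zero, Matrix.cons_val_one]
      refine ⟨?_, ?_, ?_⟩ <;> ring
    · rw [mem_ker_sysY]
      simp only [J, r, Matrix.cons_val_zero, Matrix.cons_val_one]
      refine ⟨?_, ?_, ?_⟩ <;> ring

/-- The projection `E → R0` is an isomorphism. -/
def projEquiv (A : Matrix (Fin 3) (Fin 2) 𝒪) : E A ≃ₗ[𝒪] R0 A :=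
  LinearEquiv.ofBijective (projE A) (projE_bijective A)

/-- The `dx`-component of the Spencer operator `J₂(𝒪²) → Ω¹ ⊗ J₁(𝒪²)`. -/
def spencerX (j : Jet2) : Jet1 := fun i c => dX (trunc j i c) - shiftX j i c

/-- The `dy`-component of the Spencer operator `J₂(𝒪²) → Ω¹ ⊗ J₁(𝒪²)`. -/
def spencerY (j : Jet2) : Jet1 := fun i c => dY (trunc j i c) - shiftY j i c

/-- The `dx`-component of the Spencer operator maps `E` to `R0`. -/
theorem spencerX_mem (A : Matrix (Fin 3) (Fin 2) 𝒪) (σ : E A) : spencerX σ.1 ∈ R0 A := by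
  obtain ⟨j, hj⟩ := σ
  obtain ⟨h0, hx, hy⟩ := (mem_E A j).1 hj
  rw [mem_R0] at h0
  rw [mem_ker_sysX] at hx
  rw [mem_ker_sysY] at hy
  obtain ⟨a1, a2, a3⟩ := h0
  obtain ⟨b1, b2, b3⟩ := hx
  replace a1 := congrArg dX a1
  replace a2 := congrArg dX a2
  replace a3 := congrArg dX a3
  simp only [map_add, map_zero, Derivation.leibniz, smul_eq_mul, trunc, LinearMap.coe_mk,
    AddHom.coe_mk] at a1 a2 a3
  rw [mem_R0]
  simp only [spencerX, trunc, shiftX, LinearMap.coe_mk, AddHom.coe_mk]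
  refine ⟨?_, ?_, ?_⟩
  · linear_combination a1 - b1
  · linear_combination a2 - b2
  · linear_combination a3 - b3

/-- The `dy`-component of the Spencer operator maps `E` to `R0`. -/
theorem spencerY_mem (A : Matrix (Fin 3) (Fin 2) 𝒪) (σ : E A) : spencerY σ.1 ∈ R0 A := by
  obtain ⟨j, hj⟩ := σ
  obtain ⟨h0, hx, hy⟩ := (mem_E A j).1 hj
  rw [mem_R0] at h0
  rw [mem_ker_sysX] at hx
  rw [mem_ker_sysY] at hy
  obtain ⟨a1, a2, a3⟩ := h0
  obtain ⟨b1, b2, b3⟩ := hy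
  replace a1 := congrArg dY a1
  replace a2 := congrArg dY a2
  replace a3 := congrArg dY a3
  simp only [map_add, map_zero, Derivation.leibniz, smul_eq_mul, trunc, LinearMap.coe_mk,
    AddHom.coe_mk] at a1 a2 a3
  rw [mem_R0]
  simp only [spencerY, trunc, shiftY, LinearMap.coe_mk, AddHom.coe_mk]
  refine ⟨?_, ?_, ?_⟩
  · linear_combination a1 - b1
  · linear_combination a2 - b2
  · linear_combination a3 - b3

/-- The `dx`-component of the connection `∇ : E → Ω¹ ⊗ E`: the Spencer operator
`E → Ω¹ ⊗ R0` followed by the inverse of the isomorphism `E → R0`. -/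
def nablaX (A : Matrix (Fin 3) (Fin 2) 𝒪) (σ : E A) : E A :=
  (projEquiv A).symm ⟨spencerX σ.1, spencerX_mem A σ⟩

/-- The `dy`-component of the connection `∇ : E → Ω¹ ⊗ E`. -/
def nablaY (A : Matrix (Fin 3) (Fin 2) 𝒪) (σ : E A) : E A :=
  (projEquiv A).symm ⟨spencerY σ.1, spencerY_mem A σ⟩

/-- The curvature of `(E, ∇)`, as the coefficient of `dx ∧ dy`. -/
def curvature (A : Matrix (Fin 3) (Fin 2) 𝒪) (σ : E A) : E A :=
  nablaX A (nablaY A σ) - nablaY A (nablaX A σ)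

/-- The matrix (coefficient of `dx ∧ dy`) of the curvature in a basis `e`: its `j`-th column holds
the coordinates of the curvature applied to `e j`. -/
def curvatureMatrix {A : Matrix (Fin 3) (Fin 2) 𝒪} (e : Module.Basis (Fin 3) 𝒪 (E A)) :
    Matrix (Fin 3) (Fin 3) 𝒪 :=
  Matrix.of fun i j => e.repr (curvature A (e j)) i

/-- The projection of `E` to `J₀(𝒪²) = 𝒪²`, `(b₃, b₄)`. -/
def projJ0 (A : Matrix (Fin 3) (Fin 2) 𝒪) : E A →ₗ[𝒪] (Fin 2 → 𝒪) :=
  (LinearMap.proj Idx2.o : Jet2 →ₗ[𝒪] (Fin 2 → 𝒪)).comp (E A).subtype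

/-- A basis of `E` is adapted if its first vector spans the kernel of `E → J₀(𝒪²)` and if all
rows of the curvature matrix except the first one vanish. -/
structure IsAdapted {A : Matrix (Fin 3) (Fin 2) 𝒪} (e : Module.Basis (Fin 3) 𝒪 (E A)) : Prop where
  span_eq_ker : Submodule.span 𝒪 {e 0} = LinearMap.ker (projJ0 A)
  row_eq_zero : ∀ i j, i ≠ 0 → curvatureMatrix e i j = 0

/-! ### Existence of the objects attached to a rectified web -/

theorem isUnit_of_value (f : 𝒪) (h : valueAt0 f ≠ 0) : IsUnit f := by
  obtain ⟨_, f, hf, rfl⟩ := f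
  have h' : f 0 ≠ 0 := h
  refine IsUnit.of_mul_eq_one (mkGerm f⁻¹ (hf.inv h')) (Subtype.ext (Quotient.sound' ?_))
  filter_upwards [hf.continuousAt.eventually_ne h'] with z hz
  exact mul_inv_cancel₀ hz

theorem valueAt0_mul (f g : 𝒪) : valueAt0 (f*g) = valueAt0 f * valueAt0 g :=
  (Filter.Germ.valueRingHom (x := (0 : ℂ × ℂ)) (E := ℂ)).map_mul f.1 g.1

theorem isUnit_iff_value (f : 𝒪) : IsUnit f ↔ valueAt0 f ≠ 0 := by
  refine ⟨fun h => ?_, isUnit_of_value f⟩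
  obtain ⟨g, hg⟩ := h.exists_right_inv
  have h1 : valueAt0 f * valueAt0 g = 1 := by rw [← valueAt0_mul, hg]; rfl
  exact left_ne_zero_of_mul_eq_one h1

theorem dXx : dX xGerm = 1 := by
  apply Subtype.ext
  change Filter.Germ.ofFun (fun z => fderiv ℂ Prod.fst z ((1, 0) : ℂ × ℂ)) = _
  simp [fderiv_fst]; rfl

theorem dYx : dY xGerm = 0 := by
  apply Subtype.ext
  change Filter.Germ.ofFun (fun z => fderiv ℂ Prod.fst z ((0, 1) : ℂ × ℂ)) = _
  simp [fderiv_fst]; rfl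

theorem dXy : dX yGerm = 0 := by
  apply Subtype.ext
  change Filter.Germ.ofFun (fun z => fderiv ℂ Prod.snd z ((1, 0) : ℂ × ℂ)) = _
  simp [fderiv_snd]; rfl

theorem dYy : dY yGerm = 1 := by
  apply Subtype.ext
  change Filter.Germ.ofFun (fun z => fderiv ℂ Prod.snd z ((0, 1) : ℂ × ℂ)) = _
  simp [fderiv_snd]; rfl

/-- Every nonsingular 3-web has a Blaschke curvature. -/
theorem exists_blaschke (W : Fin 3 → 𝒪) (hW : IsWeb W) : ∃ K, IsBlaschkeCurvature W K := by
  have h01 := isUnit_of_value _ (hW.transverse 0 1 (by decide))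
  have h02 := isUnit_of_value _ (hW.transverse 0 2 (by decide))
  have h12 := isUnit_of_value _ (hW.transverse 1 2 (by decide))
  let ρ : Fin 3 → 𝒪 := ![wedge (dFun (W 1)) (dFun (W 2)), -wedge (dFun (W 0)) (dFun (W 2)),
    wedge (dFun (W 0)) (dFun (W 1))]
  have hρ : ∀ i, IsUnit (ρ i) := by
    intro i; fin_cases i
    · exact h12
    · exact h02.neg
    · exact h01
  have hs : ∑ i, ρ i • dFun (W i) = 0 := by
    rw [Fin.sum_univ_three]
    ext1 <;> simp [ρ, wedge, dFun] <;> ring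
  obtain ⟨d, hd⟩ : ∃ d, wedge (ρ 0 • dFun (W 0)) (ρ 1 • dFun (W 1)) * d = 1 := by
    have : wedge (ρ 0 • dFun (W 0)) (ρ 1 • dFun (W 1)) =
      ρ 0 * ρ 1 * wedge (dFun (W 0)) (dFun (W 1)) := by simp [wedge]; ring
    rw [this]
    exact (((hρ 0).mul (hρ 1)).mul h01).exists_right_inv
  set ω : Fin 3 → 𝒪 × 𝒪 := fun i => ρ i • dFun (W i) with hω
  have h2 : ω 2 = - ω 0 - ω 1 := by
    rw [Fin.sum_univ_three] at hs
    linear_combination hs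
  refine ⟨_, ρ, (d * dForm (ω 1)) • ω 0 - (d * dForm (ω 0)) • ω 1, hρ, hs, ?_, rfl⟩
  have e0 : dForm (ω 0) = wedge ((d * dForm (ω 1)) • ω 0 - (d * dForm (ω 0)) • ω 1) (ω 0) := by
    generalize dForm (ω 0) = a at *
    generalize dForm (ω 1) = b at *
    change wedge (ω 0) (ω 1) * d = 1 at hd
    simp [wedge] at hd ⊢
    linear_combination -a * hd
  have e1 : dForm (ω 1) = wedge ((d * dForm (ω 1)) • ω 0 - (d * dForm (ω 0)) • ω 1) (ω 1) := by
    generalize dForm (ω 0) = a at *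
    generalize dForm (ω 1) = b at *
    change wedge (ω 0) (ω 1) * d = 1 at hd
    simp [wedge] at hd ⊢
    linear_combination -b * hd
  intro i
  change dForm (ω i) = wedge _ (ω i)
  fin_cases i
  · exact e0
  · exact e1
  · change dForm (ω 2) = wedge _ (ω 2)
    have : dForm (ω 2) = - dForm (ω 0) - dForm (ω 1) := by rw [h2]; simp [dForm]; ring
    rw [this, h2]
    generalize (d * dForm (ω 1)) • ω 0 - (d * dForm (ω 0)) • ω 1 = γ at *
    rw [e0, e1]; simp [wedge]; ring

/-- Quadratic interpolation at `0`, `s`, `t`. -/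
theorem interp (s t : 𝒪) (hs : IsUnit s) (ht : IsUnit t) (hst : IsUnit (s - t)) (f : 𝒪 → 𝒪) :
    ∃ a0 a1 a2, f 0 = a0 ∧ f s = a0 + a1 * s + a2 * s^2 ∧ f t = a0 + a1 * t + a2 * t^2 := by
  obtain ⟨i, hi⟩ := hs.exists_right_inv
  obtain ⟨j, hj⟩ := ht.exists_right_inv
  obtain ⟨k, hk⟩ := hst.exists_right_inv
  let d1 := (f s - f 0) * i
  let d2 := (f t - f 0) * j
  refine ⟨f 0, d1 - (d1 - d2) * k * s, (d1 - d2) * k, rfl, ?_, ?_⟩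
  · simp only [d1]; linear_combination (- (f s - f 0)) * hi
  · simp only [d2]; linear_combination (- (f t - f 0)) * hj + t * ((f s - f 0) * i - (f t - f 0) * j) * hk

/-- The system and the polynomial `P` attached to a rectified 4-web exist. -/
theorem exists_data (F₃ F₄ : 𝒪) (hW : IsWeb ![xGerm, yGerm, F₃, F₄]) (F : Polynomial 𝒪)
    (hF : IsPresentation ![xGerm, yGerm, F₃, F₄] F) :
    (∃ A, IsSystemOf F A) ∧ ∃ v₁ v₂ v₃ v₄ : 𝒪, IsLeafPolynomial ![xGerm, yGerm, F₃, F₄]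
      (-Polynomial.C v₁ * Polynomial.X ^ 3 - Polynomial.C v₂ * Polynomial.X ^ 2
        - Polynomial.C v₃ * Polynomial.X - Polynomial.C v₄) := by
  obtain ⟨u, hu, hF⟩ := hF
  have h02 := isUnit_of_value _ (hW.transverse 0 2 (by decide))
  have h03 := isUnit_of_value _ (hW.transverse 0 3 (by decide))
  have h12 := isUnit_of_value _ (hW.transverse 1 2 (by decide))
  have h13 := isUnit_of_value _ (hW.transverse 1 3 (by decide))
  have h23 := isUnit_of_value _ (hW.transverse 2 3 (by decide))
  simp [wedge, dFun, dXx, dYx, dXy, dYy] at h02 h03 h12 h13 h23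
  simp [Fin.prod_univ_four, dXx, dYx, dXy, dYy] at hF
  obtain ⟨i3, hi3⟩ := h02.exists_right_inv
  obtain ⟨i4, hi4⟩ := h03.exists_right_inv
  have hu3 : IsUnit i3 := .of_mul_eq_one _ (by rw [mul_comm]; exact hi3)
  have hu4 : IsUnit i4 := .of_mul_eq_one _ (by rw [mul_comm]; exact hi4)
  generalize hq3 : dY F₃ = q3 at *
  generalize hq4 : dY F₄ = q4 at *
  generalize hr3 : dX F₃ = r3 at *
  generalize hr4 : dX F₄ = r4 at *
  set s := -r3 * i3 with hs
  set t := -r4 * i4 with ht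
  have us : IsUnit s := h12.neg.mul hu3
  have ut : IsUnit t := h13.neg.mul hu4
  have ust : IsUnit (s - t) := by
    have : s - t = -(r3 * q4 - q3 * r4) * i3 * i4 := by
      rw [hs, ht]; linear_combination (r3 * i3) * hi4 - r4 * i4 * hi3
    rw [this]; exact (h23.neg.mul hu3).mul hu4
  have ev : ∀ p, F.eval p = (u * q3 * q4) * (p * ((p - s) * (p - t))) := by
    intro p; rw [hF, hs, ht]; simp
    linear_combination (-u * p * r3 * (q4 * p + r4)) * hi3 - u * p * (q3*p+r3*i3*q3) * r4 * hi4
  have ev' : ∀ p, F.derivative.eval p =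
      (u * q3 * q4) * ((p - s) * (p - t) + p * (p - t) + p * (p - s)) := by
    intro p; rw [hF, hs, ht]; simp
    linear_combination (-u * (2*p*q4*r3 + r3 * r4)) * hi3 - u * (2*p*q3*r4 + r3*i3*q3*r4) * hi4
  have um : IsUnit (u * q3 * q4) := (hu.mul h02).mul h03
  have roots : ∀ p, F.IsRoot p → p = 0 ∨ p = s ∨ p = t := by
    intro p hp
    have hp0 : p * ((p - s) * (p - t)) = 0 := by
      have : F.eval p = 0 := hp
      rw [ev] at this
      exact um.mul_right_eq_zero.1 this
    have key : ∀ a b : 𝒪, IsUnit (a - b) → IsUnit a ∨ IsUnit b := by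
      intro a b h
      by_contra! hn
      rw [isUnit_iff_value, isUnit_iff_value, not_not, not_not] at hn
      rw [isUnit_iff_value] at h
      apply h
      have := (Filter.Germ.valueRingHom (x := (0 : ℂ × ℂ)) (E := ℂ)).map_sub a.1 b.1
      change valueAt0 (a - b) = valueAt0 a - valueAt0 b at this
      rw [this, hn.1, hn.2, sub_zero]
    by_cases c0 : IsUnit p
    · have h1 := c0.mul_right_eq_zero.1 hp0
      rcases key (p - t) (p - s) (by convert ust using 1; ring) with h | h
      · exact Or.inr (Or.inl (sub_eq_zero.1 (h.mul_left_eq_zero.1 h1)))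
      · exact Or.inr (Or.inr (sub_eq_zero.1 (h.mul_right_eq_zero.1 h1)))
    · left
      have a1 := (key p (p - s) (by convert us using 1; ring)).resolve_left c0
      have a2 := (key p (p - t) (by convert ut using 1; ring)).resolve_left c0
      exact (a1.mul a2).mul_left_eq_zero.1 hp0
  have uD : ∀ p, F.IsRoot p → IsUnit (F.derivative.eval p) := by
    intro p hp
    rw [ev']
    apply um.mul
    rcases roots p hp with rfl | rfl | rfl
    · simpa using us.mul ut
    · simpa using us.mul ust
    · have := ut.mul ust.neg
      simpa using this
  constructor
  · let h : 𝒪 → 𝒪 := fun p => Ring.inverse (F.derivative.eval p)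
    let c : 𝒪 → 𝒪 := fun p => F.derivative.eval p * (dX (h p) + dY (h p * p))
    obtain ⟨c0, c1, c2, hc0, hcs, hct⟩ := interp s t us ut ust c
    obtain ⟨e0, e1, e2, he0, hes, het⟩ := interp s t us ut ust (fun p => dX p + p * dY p + p * c p)
    refine ⟨!![e0, c0; e1, c1; e2, c2], ?_⟩
    intro b p hp
    have hc : c p = c0 + c1 * p + c2 * p ^ 2 := by
      rcases roots p hp with rfl | rfl | rfl
      · rw [hc0]; ring
      · exact hcs
      · exact hct
    have he : dX p + p * dY p + p * c p = e0 + e1 * p + e2 * p ^ 2 := by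
      rcases roots p hp with rfl | rfl | rfl
      · rw [he0]; ring
      · exact hes
      · exact het
    have hD : F.derivative.eval p * h p = 1 := Ring.mul_inverse_cancel _ (uD p hp)
    have hcdef : c p = F.derivative.eval p * (dX (h p) + dY (h p * p)) := rfl
    simp only [branchForm, dForm, sys, jet1, LinearMap.coe_mk, AddHom.coe_mk]
    change _ * (dX (((b 0 * p + b 1) * h p) * 1) - dY (((b 0 * p + b 1) * h p) * (-p))) = _
    simp [Derivation.leibniz] at hcdef ⊢
    linear_combination (p * dX (b 0) + b 0 * dX p + dX (b 1) + p * (p * dY (b 0) + b 0 * dY p + dY (b 1))) * hD - (b 0 * p + b 1) * hcdef + b 1 * hc + b 0 * he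
  · obtain ⟨a0, a1, a2, h0, hs', ht'⟩ := interp s t us ut ust (fun p => dX p + p * dY p)
    refine ⟨0, -a2, -a1, -a0, ?_, ?_, ?_⟩
    · simp only [map_zero, neg_zero, zero_mul, zero_sub]
      compute_degree!
    · intro i p hp
      have : p = 0 ∨ p = s ∨ p = t := by
        fin_cases i
        · simp [dXx, dYx] at hp
        · left; simpa [dXy, dYy] using hp
        · right; left
          simp [hq3, hr3] at hp
          rw [hs]; linear_combination i3 * hp - p * hi3
        · right; right
          simp [hq4, hr4] at hp
          rw [ht]; linear_combination i4 * hp - p * hi4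
      have : dX p + p * dY p = a0 + a1 * p + a2 * p^2 := by
        rcases this with rfl | rfl | rfl
        · rw [h0]; ring
        · exact hs'
        · exact ht'
      rw [this]; simp; ring
    · intro i _
      simp [Polynomial.coeff_C_mul, -Polynomial.map_neg, -map_neg, Polynomial.coeff_X_pow,
        ← Polynomial.C_neg]

end

end PlaneWeb

namespace PlaneWeb

/-! Everything is expressed through logarithmic differentials of units, which are closed
(`dX_dY_log`). Let `s`, `t` be the slopes of the leaves of `F₃`, `F₄` and `m = u ∂y(F₃) ∂y(F₄)`. The
leaves of `x` contribute the factor 1 and those of `y` the factor `p`, so `F = m p (p - s)(p - t)`;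
the same two families force `v₁ = v₄ = 0`.

Evaluating the defining identity of `A` at the roots `0`, `s`, `t` determines `A`
(`IsSystemOf.coeff_eq`): `A 0 0 = A 2 1 = 0`, `A 0 1 = -∂x log(m s t)`, `A 2 0 = -∂y log m`, `A 1 0
= A 0 1 - v₃`, `A 1 1 = A 2 0 + v₂`.

Explicit normalizations (`blaschke_x_y`, `blaschke_y`, `blaschke_x`) give `K₄ = ∂x∂y log s`, `K₃ =
∂x∂y log t`, `Kx = K₃ + K₄ + ∂x v₂`, `Ky = K₃ + K₄ + ∂y v₃`. Hence `K₃ + K₄ = ∂x(A 2 0) - ∂y(A 0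
1)`, the contribution of `m` being closed; likewise `Kx = ∂x(A 1 1) - ∂y(A 0 1)` and `Ky = ∂x(A 2 0)
- ∂y(A 1 0)`.

The connection in the coordinates `b₃`, `b₄`, `∂x b₃` has a curvature that kills the 0-jet
(`curvature_coords`). Replacing `∂x b₃` by `∂x b₃ + A₂₁ b₃` and `b₄` by `-b₄` turns its remaining
row into the stated one (`curvatureMatrix_basisE`). -/

/-! ### Commuting derivatives and logarithmic differentials -/

theorem dX_dY_comm (φ : 𝒪) : dX (dY φ) = dY (dX φ) := by
  obtain ⟨_, f, hf, rfl⟩ := φ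
  apply Subtype.ext
  change Filter.Germ.ofFun
      (fun z => fderiv ℂ (fun z' => fderiv ℂ f z' ((0, 1) : ℂ × ℂ)) z ((1, 0) : ℂ × ℂ)) =
    Filter.Germ.ofFun
      (fun z => fderiv ℂ (fun z' => fderiv ℂ f z' ((1, 0) : ℂ × ℂ)) z ((0, 1) : ℂ × ℂ))
  refine Quotient.sound' ?_
  filter_upwards [hf.eventually_analyticAt] with z hz
  have hd : DifferentiableAt ℂ (fderiv ℂ f) z := hz.fderiv.differentiableAt
  have hs : IsSymmSndFDerivAt ℂ f z :=
    (hz.contDiffAt (n := 2)).isSymmSndFDerivAt (by simp)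
  have key (v w : ℂ × ℂ) : fderiv ℂ (fun z' => fderiv ℂ f z' v) z w = fderiv ℂ (fderiv ℂ f) z w v := by
    rw [fderiv_clm_apply hd (differentiableAt_const v)]
    simp
  rw [key, key, hs]

theorem derivation_inverse (d : Derivation ℤ 𝒪 𝒪) {z z' : 𝒪} (h : z * z' = 1) :
    d z' = -(z' ^ 2 * d z) := by
  have h' := congrArg d h
  simp only [Derivation.leibniz, smul_eq_mul, Derivation.map_one_eq_zero] at h'
  linear_combination z' * h' - d z' * h

/-- The logarithmic differential of a unit is closed. -/
theorem dX_dY_log {z z' : 𝒪} (h : z * z' = 1) : dX (dY z * z') = dY (dX z * z') := by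
  simp only [Derivation.leibniz, smul_eq_mul, derivation_inverse _ h, dX_dY_comm]
  ring

/-! ### Independence of the Blaschke curvature from the normalization -/

/-- The Blaschke curvature can be computed from any normalization of the web. -/
theorem IsBlaschkeCurvature.eq_dForm {W : Fin 3 → 𝒪} {K : 𝒪} (hK : IsBlaschkeCurvature W K)
    (h01 : IsUnit (wedge (dFun (W 0)) (dFun (W 1))))
    (h02 : IsUnit (wedge (dFun (W 0)) (dFun (W 2))))
    (r : Fin 3 → 𝒪) (η : Fin 3 → 𝒪 × 𝒪) (hη : ∀ i, η i = r i • dFun (W i))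
    (hr0 : IsUnit (r 0)) (hr1 : IsUnit (r 1))
    (hsum : η 0 + η 1 + η 2 = 0) (γ : 𝒪 × 𝒪)
    (e0 : dForm (η 0) = wedge γ (η 0)) (e1 : dForm (η 1) = wedge γ (η 1)) :
    K = dForm γ := by
  obtain ⟨ρ, γ', hρ, hs, hγ, rfl⟩ := hK
  rw [Fin.sum_univ_three] at hs
  obtain ⟨r', hr'⟩ := hr0.exists_right_inv
  obtain ⟨ρ', hρ'⟩ := (hρ 0).exists_right_inv
  have sx := congrArg Prod.fst hs
  have sy := congrArg Prod.snd hs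
  have nx := congrArg Prod.fst hsum
  have ny := congrArg Prod.snd hsum
  have g0 := hγ 0
  have g1 := hγ 1
  simp only [hη, dFun, Prod.fst_add, Prod.snd_add, Prod.smul_fst, Prod.smul_snd, smul_eq_mul,
    Prod.fst_zero, Prod.snd_zero] at sx sy nx ny
  simp only [wedge, dFun] at h01 h02
  -- Wedging both linear relations with `dFun (W 2)` eliminates the third coefficient, so the two
  -- normalizations differ by one common factor `l`.
  have hprop : ρ 1 * r 0 = ρ 0 * r 1 := by
    rw [← sub_eq_zero]
    apply h02.mul_right_eq_zero.1
    linear_combination ρ 1 * (dY (W 2) * nx - dX (W 2) * ny) - r 1 * (dY (W 2) * sx - dX (W 2) * sy)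
  set l := ρ 0 * r' with hl
  have hl' : l * (r 0 * ρ') = 1 := by
    rw [hl]; linear_combination ρ 0 * ρ' * hr' + hρ'
  have p0 : ρ 0 • dFun (W 0) = l • η 0 := by
    rw [hη, smul_smul]; congr 1; rw [hl]; linear_combination -ρ 0 * hr'
  have p1 : ρ 1 • dFun (W 1) = l • η 1 := by
    rw [hη, smul_smul]; congr 1; rw [hl]; linear_combination r' * hprop - ρ 1 * hr'
  set l' := r 0 * ρ' with hl''
  have hw : IsUnit (wedge (η 0) (η 1)) := by
    have : wedge (η 0) (η 1) = r 0 * r 1 * wedge (dFun (W 0)) (dFun (W 1)) := by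
      rw [hη, hη]; simp [wedge]; ring
    rw [this]
    exact (hr0.mul hr1).mul h01
  rw [p0] at g0
  rw [p1] at g1
  generalize η 0 = α at *
  generalize η 1 = β at *
  obtain ⟨α1, α2⟩ := α
  obtain ⟨β1, β2⟩ := β
  obtain ⟨a, b⟩ := γ
  obtain ⟨a', b'⟩ := γ'
  simp only [dForm, wedge, Prod.smul_mk, smul_eq_mul, Derivation.leibniz] at *
  -- The 1-form `γ' - γ - d log l` has zero wedge product with `α` and, by `q1`, with `β`. These are
  -- independent, so it vanishes, and `γ'` and `γ` have the same differential.
  have q0 : (a' - a - dX l * l') * α2 = (b' - b - dY l * l') * α1 := by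
    linear_combination (-l') * g0 + (dX α2 - dY α1 - a' * α2 + b' * α1) * hl' + e0
  have q1 : (a' - a - dX l * l') * β2 = (b' - b - dY l * l') * β1 := by
    linear_combination (-l') * g1 + (dX β2 - dY β1 - a' * β2 + b' * β1) * hl' + e1
  have ha : a' = a + dX l * l' := by
    rw [← sub_eq_zero]
    apply hw.mul_right_eq_zero.1
    linear_combination α1 * q1 - β1 * q0
  have hb : b' = b + dY l * l' := by
    rw [← sub_eq_zero]
    apply hw.mul_right_eq_zero.1
    linear_combination α2 * q1 - β2 * q0
  rw [ha, hb, map_add, map_add, dX_dY_log hl']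
  ring

/-! ### A basis of `E` -/

/-- The coordinates `(b₃, b₄, ∂x(b₃) + A₂₁ b₃)` of a 1-jet satisfying the system, with the
sign of `b₄` reversed and the order changed. -/
noncomputable def coordR0 (A : Matrix (Fin 3) (Fin 2) 𝒪) : R0 A ≃ₗ[𝒪] (Fin 3 → 𝒪) where
  toFun j := ![j.1 .x 0 + A 1 0 * j.1 .o 0, j.1 .o 0, -j.1 .o 1]
  map_add' j k := by
    funext i; fin_cases i <;> simp <;> ring
  map_smul' r j := by
    funext i; fin_cases i <;> simp <;> ring
  -- The three equations solve for `∂x b₄`, `∂y b₃` and `∂y b₄`, leaving `b₃`, `b₄` and `∂x b₃`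
  -- free.
  invFun z := ⟨fun
      | .o => ![z 1, -z 2]
      | .x => ![z 0 - A 1 0 * z 1, A 0 1 * z 2 - A 0 0 * z 1]
      | .y => ![A 2 1 * z 2 - A 2 0 * z 1, A 1 1 * z 2 - z 0], by
    rw [mem_R0]
    simp only [Matrix.cons_val_zero, Matrix.cons_val_one]
    refine ⟨?_, ?_, ?_⟩ <;> ring⟩
  left_inv j := by
    obtain ⟨j, hj⟩ := j
    rw [mem_R0] at hj
    obtain ⟨h1, h2, h3⟩ := hj
    apply Subtype.ext
    funext i c
    cases i <;> fin_cases c <;> simp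
    · linear_combination -h1
    · linear_combination -h3
    · linear_combination -h2
  right_inv z := by
    funext i; fin_cases i <;> simp

/-- The basis of `E` dual to the coordinates `∂x(b₃) + A₂₁ b₃`, `b₃`, `-b₄`. -/
noncomputable def basisE (A : Matrix (Fin 3) (Fin 2) 𝒪) : Module.Basis (Fin 3) 𝒪 (E A) :=
  Module.Basis.ofEquivFun ((projEquiv A).trans (coordR0 A))

theorem basisE_repr (A : Matrix (Fin 3) (Fin 2) 𝒪) (σ : E A) :
    ⇑((basisE A).repr σ) = ![σ.1 .x 0 + A 1 0 * σ.1 .o 0, σ.1 .o 0, -σ.1 .o 1] := rfl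

theorem basisE_coords (A : Matrix (Fin 3) (Fin 2) 𝒪) (j : Fin 3) :
    (basisE A j).1 .x 0 + A 1 0 * (basisE A j).1 .o 0 = (Pi.single j 1 : Fin 3 → 𝒪) 0 ∧
    (basisE A j).1 .o 0 = (Pi.single j 1 : Fin 3 → 𝒪) 1 ∧
    -(basisE A j).1 .o 1 = (Pi.single j 1 : Fin 3 → 𝒪) 2 := by
  have h := (basisE_repr A (basisE A j)).symm
  rw [Module.Basis.repr_self, Finsupp.single_eq_pi_single] at h
  exact ⟨congrFun h 0, congrFun h 1, congrFun h 2⟩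

theorem span_basisE_zero (A : Matrix (Fin 3) (Fin 2) 𝒪) :
    Submodule.span 𝒪 {basisE A 0} = LinearMap.ker (projJ0 A) := by
  apply le_antisymm
  · rw [Submodule.span_singleton_le_iff_mem, LinearMap.mem_ker]
    obtain ⟨-, h1, h2⟩ := basisE_coords A 0
    funext c
    fin_cases c
    · exact h1.trans (by simp)
    · exact neg_eq_zero.1 (h2.trans (by simp))
  · intro σ hσ
    rw [LinearMap.mem_ker] at hσ
    have h1 : σ.1 .o 0 = 0 := congrFun hσ 0
    have h2 : σ.1 .o 1 = 0 := congrFun hσ 1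
    rw [Submodule.mem_span_singleton]
    refine ⟨σ.1 .x 0, ?_⟩
    have h := (basisE A).sum_repr σ
    rw [Fin.sum_univ_three, basisE_repr] at h
    simpa [h1, h2] using h

/-- The coordinates on `E` read only the 1-jet, so the truncation suffices and the inverse of
`projEquiv` need not be made explicit. -/
theorem trunc_nablaX (A : Matrix (Fin 3) (Fin 2) 𝒪) (σ : E A) :
    trunc (nablaX A σ).1 = spencerX σ.1 :=
  congrArg Subtype.val ((projEquiv A).apply_symm_apply ⟨spencerX σ.1, spencerX_mem A σ⟩)

theorem trunc_nablaY (A : Matrix (Fin 3) (Fin 2) 𝒪) (σ : E A) :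
    trunc (nablaY A σ).1 = spencerY σ.1 :=
  congrArg Subtype.val ((projEquiv A).apply_symm_apply ⟨spencerY σ.1, spencerY_mem A σ⟩)

/-! ### The connection and its curvature -/

/-- The connection in the coordinates `b₃`, `b₄`, `∂x(b₃)`, in the `x`-direction. -/
theorem nablaX_coords (A : Matrix (Fin 3) (Fin 2) 𝒪) (h00 : A 0 0 = 0) (σ : E A) :
    (nablaX A σ).1 .o 0 = dX (σ.1 .o 0) - σ.1 .x 0 ∧
    (nablaX A σ).1 .o 1 = dX (σ.1 .o 1) + A 0 1 * σ.1 .o 1 ∧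
    (nablaX A σ).1 .x 0 = dX (σ.1 .x 0) + (A 0 1 + A 1 0) * σ.1 .x 0
      + (dX (A 1 0) + A 0 1 * A 1 0) * σ.1 .o 0 - (dY (A 0 1) - dX (A 1 1)) * σ.1 .o 1 := by
  have h := trunc_nablaX A σ
  have e0 := congrFun (congrFun h .o) 0
  have e1 := congrFun (congrFun h .o) 1
  have e2 := congrFun (congrFun h .x) 0
  obtain ⟨h0, hx, hy⟩ := (mem_E A σ.1).1 σ.2
  rw [mem_R0] at h0
  rw [mem_ker_sysX] at hx
  rw [mem_ker_sysY] at hy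
  simp only [h00, map_zero, zero_mul, zero_add, trunc, shiftX, spencerX, LinearMap.coe_mk,
    AddHom.coe_mk] at *
  refine ⟨e0, ?_, ?_⟩
  · linear_combination e1 - h0.1
  -- The Spencer operator brings in `∂x∂x b₃`. The `x`-derivative of the second equation trades it
  -- for `∂x∂y b₄`, which the `y`-derivative of the first equation reduces to first order.
  · linear_combination e2 - hx.2.1 + hy.1 - A 0 1 * h0.2.1 + A 1 1 * h0.1

/-- The connection in the coordinates `b₃`, `b₄`, `∂x(b₃)`, in the `y`-direction. -/
theorem nablaY_coords (A : Matrix (Fin 3) (Fin 2) 𝒪) (h21 : A 2 1 = 0) (σ : E A) :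
    (nablaY A σ).1 .o 0 = dY (σ.1 .o 0) + A 2 0 * σ.1 .o 0 ∧
    (nablaY A σ).1 .o 1 =
      dY (σ.1 .o 1) + σ.1 .x 0 + A 1 0 * σ.1 .o 0 + A 1 1 * σ.1 .o 1 ∧
    (nablaY A σ).1 .x 0 =
      dY (σ.1 .x 0) + dX (A 2 0) * σ.1 .o 0 + A 2 0 * σ.1 .x 0 := by
  have h := trunc_nablaY A σ
  have e0 := congrFun (congrFun h .o) 0
  have e1 := congrFun (congrFun h .o) 1
  have e2 := congrFun (congrFun h .x) 0
  obtain ⟨h0, hx, hy⟩ := (mem_E A σ.1).1 σ.2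
  rw [mem_R0] at h0
  rw [mem_ker_sysX] at hx
  simp only [h21, map_zero, zero_mul, add_zero, trunc, shiftY, spencerY, LinearMap.coe_mk,
    AddHom.coe_mk] at *
  refine ⟨?_, ?_, ?_⟩
  · linear_combination e0 - h0.2.2
  · linear_combination e1 - h0.2.1
  · linear_combination e2 - hx.2.2

/-- The curvature in the coordinates `b₃`, `b₄`, `∂x(b₃)`. -/
theorem curvature_coords (A : Matrix (Fin 3) (Fin 2) 𝒪) (h00 : A 0 0 = 0) (h21 : A 2 1 = 0)
    (σ : E A) :
    (curvature A σ).1 .o 0 = 0 ∧ (curvature A σ).1 .o 1 = 0 ∧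
    (curvature A σ).1 .x 0 =
      (2 * dX (A 2 0) + dX (A 1 1) - 2 * dY (A 0 1) - dY (A 1 0)) * σ.1 .x 0
      + (dX (dX (A 2 0)) - dY (dX (A 1 0)) - dY (A 0 1) * A 1 0 - A 0 1 * dY (A 1 0)
        + A 1 0 * (dX (A 1 1) - dY (A 0 1)) + (A 0 1 + A 1 0) * dX (A 2 0)) * σ.1 .o 0
      + (dY (dY (A 0 1)) - dY (dX (A 1 1)) + (A 1 1 - A 2 0) * (dX (A 1 1) - dY (A 0 1)))
        * σ.1 .o 1 := by
  have sub (i c) : (curvature A σ).1 i c =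
    (nablaX A (nablaY A σ)).1 i c - (nablaY A (nablaX A σ)).1 i c := rfl
  obtain ⟨x0, x1, x2⟩ := nablaX_coords A h00 σ
  obtain ⟨y0, y1, y2⟩ := nablaY_coords A h21 σ
  obtain ⟨xy0, xy1, xy2⟩ := nablaX_coords A h00 (nablaY A σ)
  obtain ⟨yx0, yx1, yx2⟩ := nablaY_coords A h21 (nablaX A σ)
  rw [sub, sub, sub, xy0, xy1, xy2, yx0, yx1, yx2, x0, x1, x2, y0, y1, y2]
  simp only [map_add, map_sub, Derivation.leibniz, smul_eq_mul, dX_dY_comm]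
  refine ⟨?_, ?_, ?_⟩ <;> ring

/-- The curvature matrix in the basis `basisE`, when the coefficients of the system are expressed
through those of the polynomial `P`. -/
theorem curvatureMatrix_basisE (A : Matrix (Fin 3) (Fin 2) 𝒪) (h00 : A 0 0 = 0) (h21 : A 2 1 = 0)
    {v₂ v₃ Kx Ky Λ : 𝒪} (h10 : A 1 0 = A 0 1 - v₃) (h20 : A 2 0 = A 1 1 - v₂)
    (hΛ : dX (A 2 0) - dY (A 0 1) = Λ) (hx : Kx = Λ + dX v₂) (hy : Ky = Λ + dY v₃) :
    curvatureMatrix (basisE A) =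
      !![Kx + Ky + Λ, dX Ky + v₃ * Ky, dY Kx - v₂ * Kx; 0, 0, 0; 0, 0, 0] := by
  have d20 : A 1 1 = A 2 0 + v₂ := by rw [h20]; ring
  have hxx : Kx = dX (A 1 1) - dY (A 0 1) := by
    rw [d20, map_add, hx, ← hΛ]; ring
  have hyy : Ky = dX (A 2 0) - dY (A 1 0) := by
    rw [h10, map_sub, hy, ← hΛ]; ring
  have hv3 : v₃ = A 0 1 - A 1 0 := by rw [h10]; ring
  have hv2 : v₂ = A 1 1 - A 2 0 := by rw [h20]; ring
  funext i j
  change (basisE A).repr (curvature A (basisE A j)) i = _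
  obtain ⟨c0, c1, c2⟩ := curvature_coords A h00 h21 (basisE A j)
  obtain ⟨b0, b1, b2⟩ := basisE_coords A j
  rw [basisE_repr, c0, c1, c2]
  rw [b1] at b0
  -- Substituting `∂x b₃ = z₀ - A₂₁ z₁` subtracts `A₂₁` times the first entry from the second; what
  -- survives is `∂x Ky + (A₁₂ - A₂₁) Ky`. The reversed sign of `b₄` gives the third entry its sign.
  rw [b1, eq_sub_of_add_eq b0, neg_eq_iff_eq_neg.1 b2, ← hΛ, hxx, hyy, hv3, hv2]
  fin_cases i <;> fin_cases j <;> simp [dX_dY_comm] <;> ring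

/-! ### The coefficients of the system -/

/-- The system evaluated along a root `p` of `F`, where `l` is the logarithmic derivative of `∂ₚF`
in the direction of the leaves. -/
theorem IsSystemOf.eq_at_root {F : Polynomial 𝒪} {A : Matrix (Fin 3) (Fin 2) 𝒪}
    (hA : IsSystemOf F A) {p l : 𝒪} (hp : F.eval p = 0) (hu : IsUnit (F.derivative.eval p))
    (hl : dX (F.derivative.eval p) + p * dY (F.derivative.eval p) = l * F.derivative.eval p) :
    dY p - l = A 0 1 + A 1 1 * p + A 2 1 * p ^ 2 ∧
    dX p + p * dY p + p * (A 0 1 + A 1 1 * p + A 2 1 * p ^ 2) =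
      A 0 0 + A 1 0 * p + A 2 0 * p ^ 2 := by
  have hD := Ring.mul_inverse_cancel _ hu
  -- Constant choices of `(b₃, b₄)` isolate the two columns of `A`.
  have h0 := hA ![0, 1] p hp
  have h1 := hA ![1, 0] p hp
  rw [branchForm] at h0 h1
  generalize Ring.inverse (F.derivative.eval p) = h at *
  simp only [dForm, sys, jet1, LinearMap.coe_mk, AddHom.coe_mk, Matrix.cons_val_zero,
    Matrix.cons_val_one, Matrix.cons_val, Prod.smul_mk, smul_eq_mul, map_zero,
    Derivation.map_one_eq_zero, Derivation.leibniz, map_neg, zero_mul, zero_add, one_mul,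
    mul_one, mul_zero, add_zero, derivation_inverse _ hD] at h0 h1
  generalize F.derivative.eval p = D at *
  have g0 : dY p - l = A 0 1 + A 1 1 * p + A 2 1 * p ^ 2 := by
    linear_combination h0 + ((dX D + p * dY D) * h + l - dY p) * hD + h * hl
  refine ⟨g0, ?_⟩
  linear_combination h1 - p * g0 + (p * ((dX D + p * dY D) * h + l) - 2 * p * dY p - dX p) * hD
    + p * h * hl

/-- The coefficients of the system in terms of the slopes `0`, `s`, `t` of the leaves, of the
leading coefficient `m` of `F` and of the polynomial `P`. -/
theorem IsSystemOf.coeff_eq {F : Polynomial 𝒪} {A : Matrix (Fin 3) (Fin 2) 𝒪}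
    (hA : IsSystemOf F A) {m s t m' s' t' v₂ v₃ : 𝒪}
    (hF : ∀ p, F.eval p = m * (p * ((p - s) * (p - t))))
    (hF' : ∀ p, F.derivative.eval p = m * ((p - s) * (p - t) + p * (p - t) + p * (p - s)))
    (hm : m * m' = 1) (hs : s * s' = 1) (ht : t * t' = 1) (hΔ : IsUnit (s - t))
    (hvs : dX s + s * dY s = -(v₂ * s ^ 2) - v₃ * s)
    (hvt : dX t + t * dY t = -(v₂ * t ^ 2) - v₃ * t) :
    A 0 0 = 0 ∧ A 2 1 = 0 ∧ A 1 0 = A 0 1 - v₃ ∧ A 2 0 = A 1 1 - v₂ ∧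
      A 0 1 = -(dX m * m' + dX s * s' + dX t * t') ∧ A 2 0 = -(dY m * m') := by
  have D0 : F.derivative.eval 0 = m * (s * t) := by rw [hF']; ring
  have Ds : F.derivative.eval s = m * (s * (s - t)) := by rw [hF']; ring
  have Dt : F.derivative.eval t = m * (t * (t - s)) := by rw [hF']; ring
  have um : IsUnit m := .of_mul_eq_one _ hm
  have us : IsUnit s := .of_mul_eq_one _ hs
  have ut : IsUnit t := .of_mul_eq_one _ ht
  have hΔ' : IsUnit (t - s) := by simpa using hΔ.neg
  have mx : dX m = dX m * m' * m := by linear_combination -dX m * hm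
  have my : dY m = dY m * m' * m := by linear_combination -dY m * hm
  have sx : dX s = dX s * s' * s := by linear_combination -dX s * hs
  have tx : dX t = dX t * t' * t := by linear_combination -dX t * ht
  -- The leaf equation divided by the slope replaces `∂y s` by `∂x log s`, so only logarithmic
  -- derivatives and `v₂`, `v₃` remain.
  have sy : dY s = -v₂ * s - v₃ - dX s * s' := by
    linear_combination s' * hvs - (dY s + v₂ * s + v₃) * hs
  have ty : dY t = -v₂ * t - v₃ - dX t * t' := by
    linear_combination t' * hvt - (dY t + v₂ * t + v₃) * ht
  generalize dX m * m' = μ at *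
  generalize dY m * m' = ν at *
  generalize dX s * s' = L at *
  generalize dX t * t' = N at *
  obtain ⟨c0, e0⟩ := hA.eq_at_root (p := 0) (l := μ + L + N) (by rw [hF]; ring)
    (by rw [D0]; exact um.mul (us.mul ut))
    (by rw [D0]; simp only [Derivation.leibniz, smul_eq_mul]; rw [mx, sx, tx]; ring)
  -- Here `l` is the derivative of `log m + log s + log(s - t)` along slope `s`: the terms are `μ +
  -- s ν`, then `-v₂ s - v₃`, then `N - v₂ s` (compare `slope_sub_deriv`).
  obtain ⟨cs, es⟩ := hA.eq_at_root (p := s) (l := μ + s * ν - v₂ * s - v₃ + N - v₂ * s)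
    (by rw [hF]; ring) (by rw [Ds]; exact um.mul (us.mul hΔ))
    (by
      rw [Ds]; simp only [Derivation.leibniz, smul_eq_mul, map_sub]
      rw [mx, sx, tx, my, sy, ty]; ring)
  obtain ⟨ct, et⟩ := hA.eq_at_root (p := t) (l := μ + t * ν - v₂ * t - v₃ + L - v₂ * t)
    (by rw [hF]; ring) (by rw [Dt]; exact um.mul (ut.mul hΔ'))
    (by
      rw [Dt]; simp only [Derivation.leibniz, smul_eq_mul, map_sub]
      rw [mx, sx, tx, my, sy, ty]; ring)
  have a00 : A 0 0 = 0 := by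
    simp only [map_zero] at e0
    linear_combination -e0
  have a01 : A 0 1 = -(μ + L + N) := by
    simp only [map_zero] at c0
    linear_combination -c0
  have bs : A 1 1 + A 2 1 * s = v₂ - ν := us.mul_left_cancel (by
    linear_combination -cs + sy - a01)
  have bt : A 1 1 + A 2 1 * t = v₂ - ν := ut.mul_left_cancel (by
    linear_combination -ct + ty - a01)
  -- A polynomial of degree at most 1 in `p` with equal values at `s` and `t` is constant, since `s
  -- - t` is a unit.
  have a21 : A 2 1 = 0 := hΔ.mul_left_eq_zero.1 (by linear_combination bs - bt)
  have a11 : A 1 1 = v₂ - ν := by linear_combination bs - s * a21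
  have fs : A 1 0 + A 2 0 * s = A 0 1 - v₃ + (A 1 1 - v₂) * s := us.mul_left_cancel (by
    linear_combination -es + hvs - a00 + s ^ 3 * a21)
  have ft : A 1 0 + A 2 0 * t = A 0 1 - v₃ + (A 1 1 - v₂) * t := ut.mul_left_cancel (by
    linear_combination -et + hvt - a00 + t ^ 3 * a21)
  have a20 : A 2 0 = A 1 1 - v₂ := by
    rw [← sub_eq_zero]
    exact hΔ.mul_left_eq_zero.1 (by linear_combination fs - ft)
  refine ⟨a00, a21, ?_, a20, a01, ?_⟩
  · linear_combination fs - s * a20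
  · rw [a20, a11]; ring

/-! ### Blaschke curvatures of the extracted 3-webs -/

/-- The Blaschke curvature of the web formed by `x`, `y` and leaves of slope `s`. -/
theorem blaschke_x_y {G s s' K : 𝒪} (hK : IsBlaschkeCurvature ![xGerm, yGerm, G] K)
    (hq : IsUnit (dY G)) (hs : s * s' = 1) (hG : dX G + s * dY G = 0) :
    K = dX (dY s * s') := by
  obtain ⟨i, hi⟩ := hq.exists_right_inv
  have us : IsUnit s := .of_mul_eq_one _ hs
  -- The normalized forms are `s dx`, `-dy`, `dy - s dx`, with `γ = ∂y log s dy`.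
  have h := hK.eq_dForm (r := ![s, -1, i]) (η := ![(s, 0), (0, -1), (-s, 1)]) (γ := (0, dY s * s'))
    (by simp [wedge, dFun, dXx, dYx, dXy, dYy]) (by simpa [wedge, dFun, dXx, dYx] using hq)
    (by
      intro j
      fin_cases j
      · simp [dFun, dXx, dYx]
      · simp [dFun, dXy, dYy]
      · ext1
        · simp [dFun]; linear_combination -i * hG + s * hi
        · simp [dFun]; linear_combination -hi)
    (by simpa using us) (by simp) (by simp)
    (by simp [dForm, wedge]; linear_combination -dY s * hs)
    (by simp [dForm, wedge])
  simpa [dForm] using h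

variable {G₃ G₄ s t s' t' K v₂ v₃ : 𝒪}

/-- The derivative of `s - t` in the direction of slope `s`, for slopes `s`, `t` of solutions of
`y'' = P(x, y, y')`. -/
theorem slope_sub_deriv (ht : t * t' = 1)
    (hvs : dX s + s * dY s = -(v₂ * s ^ 2) - v₃ * s)
    (hvt : dX t + t * dY t = -(v₂ * t ^ 2) - v₃ * t) :
    dX (s - t) + s * dY (s - t) = (dX t * t' - v₂ * s) * (s - t) := by
  have tx : dX t = dX t * t' * t := by linear_combination -dX t * ht
  have ty : dY t = -v₂ * t - v₃ - dX t * t' := by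
    linear_combination t' * hvt - (dY t + v₂ * t + v₃) * ht
  rw [map_sub, map_sub]
  -- The left side is `P(s) - P(t) - (s - t) ∂y t`, and `P(s) - P(t)` is divisible by `s - t`.
  linear_combination hvs - tx - s * ty

/-- The Blaschke curvature of the web formed by `y` and leaves of slopes `s`, `t`. -/
theorem blaschke_y (hK : IsBlaschkeCurvature ![yGerm, G₃, G₄] K)
    (hq₃ : IsUnit (dY G₃)) (hq₄ : IsUnit (dY G₄)) (hs : s * s' = 1) (ht : t * t' = 1)
    (hΔ : IsUnit (s - t)) (hG₃ : dX G₃ + s * dY G₃ = 0) (hG₄ : dX G₄ + t * dY G₄ = 0)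
    (hvs : dX s + s * dY s = -(v₂ * s ^ 2) - v₃ * s)
    (hvt : dX t + t * dY t = -(v₂ * t ^ 2) - v₃ * t) :
    K = dX (dY s * s') + dX (dY t * t') + dX v₂ := by
  obtain ⟨i₃, hi₃⟩ := hq₃.exists_right_inv
  obtain ⟨i₄, hi₄⟩ := hq₄.exists_right_inv
  obtain ⟨Δ', hΔ'⟩ := hΔ.exists_right_inv
  have us : IsUnit s := .of_mul_eq_one _ hs
  have ut : IsUnit t := .of_mul_eq_one _ ht
  have ui₃ : IsUnit i₃ := .of_mul_eq_one_right _ hi₃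
  -- The forms are `(s - t) dy`, `t (dy - s dx)`, `-s (dy - t dx)`, and `γ = d log(s - t) + (v₂ + ∂y
  -- log(s t)) dy`. The closed part `d log(s - t)` drops out of the curvature.
  have h := hK.eq_dForm (r := ![s - t, t * i₃, -(s * i₄)])
    (η := ![(0, s - t), (-(t * s), t), (s * t, -s)])
    (γ := (dX (s - t) * Δ', v₂ + dY s * s' + dY t * t' + dY (s - t) * Δ'))
    (by
      have : dX G₃ = -(s * dY G₃) := by linear_combination hG₃
      simpa [wedge, dFun, dXy, dYy, this] using us.mul hq₃)
    (by
      have : dX G₄ = -(t * dY G₄) := by linear_combination hG₄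
      simpa [wedge, dFun, dXy, dYy, this] using ut.mul hq₄)
    (by
      intro j
      fin_cases j
      · simp [dFun, dXy, dYy]
      · ext1
        · simp [dFun]; linear_combination -t * i₃ * hG₃ + t * s * hi₃
        · simp [dFun]; linear_combination -t * hi₃
      · ext1
        · simp [dFun]; linear_combination s * i₄ * hG₄ - s * t * hi₄
        · simp [dFun]; linear_combination -s * hi₄)
    hΔ (ut.mul ui₃) (by simp; ring)
    (by
      simp only [dForm, wedge, Matrix.cons_val_zero, map_zero]
      linear_combination -dX (s - t) * hΔ')
    (by
      have key := slope_sub_deriv ht hvs hvt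
      simp only [dForm, wedge, Matrix.cons_val_zero, Matrix.cons_val_one, map_neg, Derivation.leibniz, smul_eq_mul]
      linear_combination -t * Δ' * key - t * (dX t * t' - v₂ * s) * hΔ' - t * dY s * hs
        - s * dY t * ht - dX t * ht)
  simp only [dForm, map_add, dX_dY_log hΔ'] at h
  rw [h]; ring

/-- The Blaschke curvature of the web formed by `x` and leaves of slopes `s`, `t`. -/
theorem blaschke_x (hK : IsBlaschkeCurvature ![xGerm, G₃, G₄] K)
    (hq₃ : IsUnit (dY G₃)) (hq₄ : IsUnit (dY G₄)) (hs : s * s' = 1) (ht : t * t' = 1)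
    (hΔ : IsUnit (s - t)) (hG₃ : dX G₃ + s * dY G₃ = 0) (hG₄ : dX G₄ + t * dY G₄ = 0)
    (hvs : dX s + s * dY s = -(v₂ * s ^ 2) - v₃ * s)
    (hvt : dX t + t * dY t = -(v₂ * t ^ 2) - v₃ * t) :
    K = dX (dY s * s') + dX (dY t * t') + dY v₃ := by
  obtain ⟨i₃, hi₃⟩ := hq₃.exists_right_inv
  obtain ⟨i₄, hi₄⟩ := hq₄.exists_right_inv
  obtain ⟨Δ', hΔ'⟩ := hΔ.exists_right_inv
  have ui₃ : IsUnit i₃ := .of_mul_eq_one_right _ hi₃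
  -- The forms are `(s - t) dx`, `dy - s dx`, `t dx - dy`, and `γ = d log(s - t) - (∂x log(s t) +
  -- v₃) dx`.
  have h := hK.eq_dForm (r := ![s - t, i₃, -i₄])
    (η := ![(s - t, 0), (-s, 1), (t, -1)])
    (γ := (dX (s - t) * Δ' - dX s * s' - dX t * t' - v₃, dY (s - t) * Δ'))
    (by simpa [wedge, dFun, dXx, dYx] using hq₃)
    (by simpa [wedge, dFun, dXx, dYx] using hq₄)
    (by
      intro j
      fin_cases j
      · simp [dFun, dXx, dYx]
      · ext1
        · simp [dFun]; linear_combination -i₃ * hG₃ + s * hi₃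
        · simp [dFun]; linear_combination -hi₃
      · ext1
        · simp [dFun]; linear_combination i₄ * hG₄ - t * hi₄
        · simp [dFun]; linear_combination -hi₄)
    hΔ ui₃ (by simp; ring)
    (by
      simp only [dForm, wedge, Matrix.cons_val_zero, map_zero]
      linear_combination dY (s - t) * hΔ')
    (by
      have key := slope_sub_deriv ht hvs hvt
      simp only [dForm, wedge, Matrix.cons_val_zero, Matrix.cons_val_one, map_neg, Derivation.map_one_eq_zero]
      linear_combination -Δ' * key - (dX t * t' - v₂ * s) * hΔ' + s' * hvs
        - (dY s + v₂ * s + v₃) * hs)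
  rw [h, dX_dY_log hs, dX_dY_log ht]
  change dX (dY (s - t) * Δ') - dY (dX (s - t) * Δ' - dX s * s' - dX t * t' - v₃) = _
  rw [dX_dY_log hΔ']
  simp only [map_sub dY (_ - _ : 𝒪) v₃, map_sub dY (_ - _ : 𝒪) (dX t * t'),
    map_sub dY (_ : 𝒪) (dX s * s')]
  ring

end PlaneWeb

/-! ### The curvature of a rectified 4-web -/

open PlaneWeb in
/-- The curvature of a rectified 4-web in an adapted basis, in terms of the Blaschke curvatures of
its extracted 3-webs. -/
theorem proposition3 (F₃ F₄ : PlaneWeb.𝒪)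
    (hW : PlaneWeb.IsWeb ![PlaneWeb.xGerm, PlaneWeb.yGerm, F₃, F₄])
    (F : Polynomial PlaneWeb.𝒪)
    (hF : PlaneWeb.IsPresentation ![PlaneWeb.xGerm, PlaneWeb.yGerm, F₃, F₄] F)
    (A : Matrix (Fin 3) (Fin 2) PlaneWeb.𝒪) (hA : PlaneWeb.IsSystemOf F A)
    (v₁ v₂ v₃ v₄ : PlaneWeb.𝒪)
    (hP : PlaneWeb.IsLeafPolynomial ![PlaneWeb.xGerm, PlaneWeb.yGerm, F₃, F₄]
      (-Polynomial.C v₁ * Polynomial.X ^ 3 - Polynomial.C v₂ * Polynomial.X ^ 2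
        - Polynomial.C v₃ * Polynomial.X - Polynomial.C v₄))
    (Kx Ky K₃ K₄ : PlaneWeb.𝒪)
    (hKx : PlaneWeb.IsBlaschkeCurvature ![PlaneWeb.yGerm, F₃, F₄] Kx)
    (hKy : PlaneWeb.IsBlaschkeCurvature ![PlaneWeb.xGerm, F₃, F₄] Ky)
    (hK₃ : PlaneWeb.IsBlaschkeCurvature ![PlaneWeb.xGerm, PlaneWeb.yGerm, F₄] K₃)
    (hK₄ : PlaneWeb.IsBlaschkeCurvature ![PlaneWeb.xGerm, PlaneWeb.yGerm, F₃] K₄) :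
    ∃ e : Module.Basis (Fin 3) PlaneWeb.𝒪 (PlaneWeb.E A), PlaneWeb.IsAdapted e ∧
      PlaneWeb.curvatureMatrix e =
        !![Kx + Ky + K₃ + K₄, PlaneWeb.dX Ky + v₃ * Ky, PlaneWeb.dY Kx - v₂ * Kx;
           0, 0, 0;
           0, 0, 0] := by
  obtain ⟨u, hu, hF⟩ := hF
  have u₃ := isUnit_of_value _ (hW.transverse 0 2 (by decide))
  have u₄ := isUnit_of_value _ (hW.transverse 0 3 (by decide))
  have h12 := isUnit_of_value _ (hW.transverse 1 2 (by decide))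
  have h13 := isUnit_of_value _ (hW.transverse 1 3 (by decide))
  have h23 := isUnit_of_value _ (hW.transverse 2 3 (by decide))
  simp [wedge, dFun, dXx, dYx, dXy, dYy] at u₃ u₄ h12 h13 h23
  simp [Fin.prod_univ_four, dXx, dYx, dXy, dYy] at hF
  obtain ⟨s, hs⟩ : ∃ s, dX F₃ = -(s * dY F₃) := by
    obtain ⟨i, hi⟩ := u₃.exists_right_inv
    exact ⟨-(dX F₃ * i), by linear_combination -dX F₃ * hi⟩
  obtain ⟨t, ht⟩ : ∃ t, dX F₄ = -(t * dY F₄) := by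
    obtain ⟨i, hi⟩ := u₄.exists_right_inv
    exact ⟨-(dX F₄ * i), by linear_combination -dX F₄ * hi⟩
  have hs0 : dX F₃ + s * dY F₃ = 0 := by rw [hs]; ring
  have ht0 : dX F₄ + t * dY F₄ = 0 := by rw [ht]; ring
  have us : IsUnit s := by
    rw [hs, IsUnit.neg_iff] at h12
    exact isUnit_of_mul_isUnit_left h12
  have ut : IsUnit t := by
    rw [ht, IsUnit.neg_iff] at h13
    exact isUnit_of_mul_isUnit_left h13
  have hΔ : IsUnit (s - t) := by
    have : dX F₃ * dY F₄ - dY F₃ * dX F₄ = -((s - t) * (dY F₃ * dY F₄)) := by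
      rw [hs, ht]; ring
    rw [this, IsUnit.neg_iff] at h23
    exact isUnit_of_mul_isUnit_left h23
  obtain ⟨s', hs'⟩ := us.exists_right_inv
  obtain ⟨t', ht'⟩ := ut.exists_right_inv
  obtain ⟨m', hm'⟩ := ((hu.mul u₃).mul u₄).exists_right_inv
  have hv₁ : v₁ = 0 := by
    have h := hP.vertical 0 dYx
    rw [← Polynomial.C_neg] at h
    simp only [Polynomial.coeff_sub, Polynomial.coeff_C_mul, Polynomial.coeff_X_pow,
      Polynomial.coeff_X, Polynomial.coeff_C] at h
    simpa using h
  -- The leaves of `y` have slope 0, so `P(0) = 0`.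
  have hv₄ : v₄ = 0 := by
    have := hP.eval_slope 1 0 (by simp [dXy])
    simpa using this
  have hvs := hP.eval_slope 2 s hs0
  have hvt := hP.eval_slope 3 t ht0
  simp [hv₁, hv₄] at hvs hvt
  obtain ⟨a00, a21, a10, a20, a01, a20'⟩ := hA.coeff_eq (m := u * dY F₃ * dY F₄)
    (fun p => by rw [hF, hs, ht]; simp; ring) (fun p => by rw [hF, hs, ht]; simp; ring)
    hm' hs' ht' hΔ hvs.symm hvt.symm
  -- Closedness of `d log m` removes `m`, and with it the choice of the unit `u`; only `∂x∂y log s +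
  -- ∂x∂y log t` is left.
  have hΛ : dX (A 2 0) - dY (A 0 1) = K₃ + K₄ := by
    rw [blaschke_x_y hK₃ u₄ ht' ht0, blaschke_x_y hK₄ u₃ hs' hs0, a20', a01, map_neg, map_neg,
      map_add, map_add, dX_dY_log hm', dX_dY_log hs', dX_dY_log ht']
    ring
  have hx : Kx = K₃ + K₄ + dX v₂ := by
    rw [blaschke_x_y hK₃ u₄ ht' ht0, blaschke_x_y hK₄ u₃ hs' hs0,
      blaschke_y hKx u₃ u₄ hs' ht' hΔ hs0 ht0 hvs.symm hvt.symm]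
    ring
  have hy : Ky = K₃ + K₄ + dY v₃ := by
    rw [blaschke_x_y hK₃ u₄ ht' ht0, blaschke_x_y hK₄ u₃ hs' hs0,
      blaschke_x hKy u₃ u₄ hs' ht' hΔ hs0 ht0 hvs.symm hvt.symm]
    ring
  have hcurv := curvatureMatrix_basisE A a00 a21 a10 a20 hΛ hx hy
  rw [← add_assoc] at hcurv
  refine ⟨basisE A, ⟨span_basisE_zero A, fun i j hi => ?_⟩, hcurv⟩
  rw [hcurv]
  fin_cases i
  · exact absurd rfl hi
  · fin_cases j <;> rfl
  · fin_cases j <;> rfl
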